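/- Let $\omega$ be a factor, i.e. a complex $*$-algebra that is $*$-isomorphic to the algebra $\mathrm{Lin}(\mathcal H_\Omega)$ of all linear operators on some finite-dimensional complex Hilbert space $\mathcal H_\Omega$. Let $(\mathcal A_1, \mathcal A_2)$ be a bipartition of $\omega$, i.e. a pair of unital $*$-subalgebras of $\omega$ such that $\mathcal A_2$ is the commutant of $\mathcal A_1$, $\mathcal A_2 = \mathcal A_1' := \{f \in \omega \mid \forall a \in \mathcal A_1,\ fa = af\}$. Then there exist a finite set $K$, two families of finite-dimensional complex Hilbert spaces $(\mathcal H_{A_1^k})_{k\in K}$ and $(\mathcal H_{A_2^k})_{k\in K}$, and a $*$-isomorphism $$\iota \colon \omega \to \mathrm{Lin}_\Delta(\mathcal H_{A_1} \otimes \mathcal H_{A_2}), \qquad \mathcal H_{A_n} := \bigoplus_{k \in K} \mathcal H_{A_n^k},$$ such that $$\iota(\mathcal A_1) = \{ (f \otimes \mathrm{id})\, \tilde\Pi \mid f \in \mathrm{Lin}_\delta(\mathcal H_{A_1}) \}, \qquad \iota(\mathcal A_2) = \{ (\mathrm{id} \otimes g)\, \tilde\Pi \mid g \in \mathrm{Lin}_\delta(\mathcal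 H_{A_2}) \}.$$ Here $\mathrm{Lin}_\delta(\mathcal H_{A_n})$ is the set of block-diagonal operators, i.e. the linear operators on $\mathcal H_{A_n}$ that map each summand $\mathcal H_{A_n^k}$ into itself; $\tilde\Pi := \sum_{k\in K} \Pi_{A_1}^k \otimes \Pi_{A_2}^k$, where $\Pi_{A_n}^k$ is the orthogonal projector of $\mathcal H_{A_n}$ onto $\mathcal H_{A_n^k}$; and $\mathrm{Lin}_\Delta(\mathcal H_{A_1} \otimes \mathcal H_{A_2})$ is the $*$-algebra (under composition and the adjoint, with unit $\tilde\Pi$) of the linear operators $T$ on $\mathcal H_{A_1} \otimes \mathcal H_{A_2}$ such that, for all $k_1, k_2 \in K$, $$T\left(\mathcal H_{A_1^{k_1}} \otimes \mathcal H_{A_2^{k_2}}\right) \subseteq \bigoplus_{(k_1', k_2') \,:\, \Delta_{k_1k_2}^{k_1'k_2'} = 1} \mathcal H_{A_1^{k_1'}} \otimes \mathcal H_{A_2^{k_2'}}, \qquad \Delta_{k_1k_2}^{k_1'k_2'} := \delta_{k_1k_2}\,\delta^{k_1'k_2'}.$$ -/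

import Mathlib

open scoped TensorProduct

universe u v

/-- A *factor*: a complex *-algebra that is *-isomorphic to the algebra of all linear operators
on some finite-dimensional complex Hilbert space (the star of an operator is its adjoint). -/
def IsFactor (ω : Type u) [Ring ω] [StarRing ω] [Algebra ℂ ω] [StarModule ℂ ω] : Prop :=
  ∃ (H : Type v) (_ : NormedAddCommGroup H) (_ : InnerProductSpace ℂ H)
    (_ : FiniteDimensional ℂ H), Nonempty (ω ≃⋆ₐ[ℂ] (H →ₗ[ℂ] H))

/-- A pair of sub-C*-algebras is a *bipartition* of the ambient algebra if the second one is the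
commutant of the first one. -/
def IsBipartition {ω : Type u} [Ring ω] [StarRing ω] [Algebra ℂ ω] [StarModule ℂ ω]
    (A₁ A₂ : StarSubalgebra ℂ ω) : Prop :=
  (A₂ : Set ω) = {f : ω | ∀ a ∈ A₁, f * a = a * f}

/-- A sectorisation of `H`: an orthogonal direct sum decomposition of `H` indexed by `K`. -/
structure Sectorisation (K : Type*) (H : Type*) [NormedAddCommGroup H]
    [InnerProductSpace ℂ H] where
  sector : K → Submodule ℂ H
  orthogonal : ∀ j k, j ≠ k → sector j ⟂ sector k
  spans : ⨆ k, sector k = ⊤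

namespace Sectorisation

section Routes

variable {K L : Type*} {H H' : Type*} [NormedAddCommGroup H] [InnerProductSpace ℂ H]
  [NormedAddCommGroup H'] [InnerProductSpace ℂ H']

/-- `Lin_η(H, H')`: the linear maps that follow the route `η`, i.e. that send each sector `k` into
the sum of the sectors `l` with `η k l`. -/
def linRoute (S : Sectorisation K H) (T : Sectorisation L H') (η : K → L → Prop) :
    Submodule ℂ (H →ₗ[ℂ] H') where
  carrier := {f | ∀ k, ∀ x ∈ S.sector k, f x ∈ ⨆ l, ⨆ _ : η k l, T.sector l}
  add_mem' hf hg k x hx := add_mem (hf k x hx) (hg k x hx)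
  zero_mem' k x _ := by simp
  smul_mem' c f hf k x hx := Submodule.smul_mem _ c (hf k x hx)

theorem mul_mem_linRoute (S : Sectorisation K H) {η : K → K → Prop}
    (htrans : ∀ i j k, η i j → η j k → η i k) {f g : H →ₗ[ℂ] H}
    (hf : f ∈ S.linRoute S η) (hg : g ∈ S.linRoute S η) : f * g ∈ S.linRoute S η := by
  intro k x hx
  have h : (⨆ l, ⨆ _ : η k l, S.sector l) ≤
      Submodule.comap f (⨆ l, ⨆ _ : η k l, S.sector l) := by
    refine iSup₂_le fun l hl y hy => ?_
    have h2 : (⨆ m, ⨆ _ : η l m, S.sector m) ≤ ⨆ m, ⨆ _ : η k m, S.sector m :=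
      iSup₂_le fun m hm => le_iSup₂_of_le m (htrans _ _ _ hl hm) le_rfl
    exact h2 (hf l y hy)
  exact h (hg k x hx)

theorem star_mem_linRoute [FiniteDimensional ℂ H] (S : Sectorisation K H) {η : K → K → Prop}
    (hsymm : ∀ j k, η j k → η k j) {f : H →ₗ[ℂ] H}
    (hf : f ∈ S.linRoute S η) : star f ∈ S.linRoute S η := by
  classical
  intro k x hx
  set W := ⨆ l, ⨆ _ : η k l, S.sector l with hW
  set W' := ⨆ l, ⨆ _ : ¬ η k l, S.sector l with hW'
  have hperp : W ⟂ W' := by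
    simp only [hW, hW', Submodule.isOrtho_iSup_left, Submodule.isOrtho_iSup_right]
    intro i hi j hj
    refine S.orthogonal _ _ ?_
    rintro rfl
    exact hi hj
  have htop : star f x ∈ W ⊔ W' := by
    have : W ⊔ W' = ⊤ := by
      rw [eq_top_iff, ← S.spans]
      refine iSup_le fun l => ?_
      by_cases h : η k l
      · exact le_sup_of_le_left (le_iSup₂_of_le l h le_rfl)
      · exact le_sup_of_le_right (le_iSup₂_of_le l h le_rfl)
    rw [this]; trivial
  have hx' : star f x ∈ W'ᗮ := by
    have : W' ≤ (Submodule.span ℂ {star f x})ᗮ := by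
      refine iSup₂_le fun j hj y hy => ?_
      rw [Submodule.mem_orthogonal_singleton_iff_inner_right]
      change inner ℂ (LinearMap.adjoint f x) y = 0
      rw [LinearMap.adjoint_inner_left]
      have hsub : S.sector k ⟂ (⨆ l, ⨆ _ : η j l, S.sector l) := by
        simp only [Submodule.isOrtho_iSup_right]
        intro l hl
        refine S.orthogonal _ _ ?_
        rintro rfl
        exact hj (hsymm _ _ hl)
      exact hsub.inner_eq hx (hf j y hy)
    rw [Submodule.mem_orthogonal']
    intro y hy
    exact (Submodule.mem_orthogonal_singleton_iff_inner_right).1 (this hy)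
  obtain ⟨w, hw, w', hw', hsum⟩ := Submodule.mem_sup.1 htop
  have hw0 : w' = 0 := by
    have h1 : w' ∈ W'ᗮ := by
      have : w' = star f x - w := by rw [← hsum]; abel
      rw [this]
      exact sub_mem hx' (hperp hw)
    exact (Submodule.mem_bot ℂ).1 ((Submodule.inf_orthogonal_eq_bot W') ▸ ⟨hw', h1⟩)
  rw [← hsum, hw0, add_zero]
  exact hw

/-- `Lin_η(H)` as a C*-algebra, for a partial equivalence relation `η`. Its unit need not be the
identity operator of `H`, whence the non-unital subalgebra of the operators on `H`. -/
def algRoute [FiniteDimensional ℂ H] (S : Sectorisation K H) (η : K → K → Prop)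
    (hsymm : ∀ j k, η j k → η k j) (htrans : ∀ i j k, η i j → η j k → η i k) :
    NonUnitalStarSubalgebra ℂ (H →ₗ[ℂ] H) where
  carrier := S.linRoute S η
  add_mem' := add_mem
  zero_mem' := zero_mem _
  smul_mem' c _ hf := Submodule.smul_mem _ c hf
  mul_mem' := S.mul_mem_linRoute htrans
  star_mem' := S.star_mem_linRoute hsymm

/-- The orthogonal projector of `H` onto its sector `k`. -/
noncomputable def projector [FiniteDimensional ℂ H] (S : Sectorisation K H) (k : K) :
    H →ₗ[ℂ] H :=
  ((S.sector k).starProjection : H →ₗ[ℂ] H)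

/-- The sectorisation of `H ⊗ H'` with sectors `H^k ⊗ H'^l`, indexed by pairs `(k, l)`. -/
noncomputable def tensor (S : Sectorisation K H) (T : Sectorisation L H') :
    Sectorisation (K × L) (H ⊗[ℂ] H') where
  sector p := Submodule.map₂ (TensorProduct.mk ℂ H H') (S.sector p.1) (T.sector p.2)
  orthogonal := by
    rintro ⟨i, j⟩ ⟨k, l⟩ h
    rw [Submodule.map₂_eq_span_image2, Submodule.map₂_eq_span_image2, Submodule.isOrtho_span]
    rintro _ ⟨x, hx, y, hy, rfl⟩ _ ⟨z, hz, w, hw, rfl⟩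
    simp only [TensorProduct.mk_apply, TensorProduct.inner_tmul]
    by_cases hik : i = k
    · have hjl : j ≠ l := fun e => h (by rw [hik, e])
      rw [(T.orthogonal _ _ hjl).inner_eq hy hw, mul_zero]
    · rw [(S.orthogonal _ _ hik).inner_eq hx hz, zero_mul]
  spans := by
    rw [iSup_prod]
    simp only [← Submodule.map₂_iSup_right, ← Submodule.map₂_iSup_left, S.spans, T.spans]
    exact TensorProduct.map₂_mk_top_top_eq_top ℂ H H'

end Routes

/-- The Hilbert space `⨁ k, H k`, sectorised by its summands: the sector `k` consists of the vectors
whose components other than the `k`-th one vanish. -/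
noncomputable def directSum {K : Type*} [Fintype K] (H : K → Type*) [∀ k, NormedAddCommGroup (H k)]
    [∀ k, InnerProductSpace ℂ (H k)] : Sectorisation K (PiLp 2 H) where
  sector k :=
    { carrier := {x | ∀ j, j ≠ k → x j = 0}
      add_mem' := fun hx hy j hj => by simp [hx j hj, hy j hj]
      zero_mem' := fun j _ => rfl
      smul_mem' := fun c x hx j hj => by simp [hx j hj] }
  orthogonal j k h := by
    rw [Submodule.isOrtho_iff_inner_eq]
    intro x hx y hy
    rw [PiLp.inner_apply]
    refine Finset.sum_eq_zero fun i _ => ?_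
    by_cases hi : i = j
    · have hik : i ≠ k := fun e => h (hi ▸ e)
      rw [hy i hik, inner_zero_right]
    · rw [hx i hi, inner_zero_left]
  spans := by
    classical
    rw [eq_top_iff]
    intro x _
    have hx : x = ∑ k, WithLp.toLp 2 (Pi.single k (x k)) := by
      ext i
      simp [Finset.sum_apply, WithLp.ofLp_sum]
    rw [hx]
    refine sum_mem fun k _ => Submodule.mem_iSup_of_mem k ?_
    intro j hj
    simp [Pi.single_eq_of_ne hj]

end Sectorisation

/-- The route `Δ` on pairs of labels: both input labels are equal, both output labels are equal. -/
def routeDelta (K : Type*) (p q : K × K) : Prop := p.1 = p.2 ∧ q.1 = q.2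

section Extended

variable {K : Type*} [Fintype K] (H₁ H₂ : K → Type*)
  [∀ k, NormedAddCommGroup (H₁ k)] [∀ k, InnerProductSpace ℂ (H₁ k)]
  [∀ k, FiniteDimensional ℂ (H₁ k)]
  [∀ k, NormedAddCommGroup (H₂ k)] [∀ k, InnerProductSpace ℂ (H₂ k)]
  [∀ k, FiniteDimensional ℂ (H₂ k)]

/-- The extended Hilbert space `(⨁ k, H₁ k) ⊗ (⨁ l, H₂ l)`. -/
abbrev HExt : Type _ := PiLp 2 H₁ ⊗[ℂ] PiLp 2 H₂

/-- The C*-algebra `Lin_Δ` of operators on the extended Hilbert space. -/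
noncomputable def linDelta : NonUnitalStarSubalgebra ℂ (HExt H₁ H₂ →ₗ[ℂ] HExt H₁ H₂) :=
  ((Sectorisation.directSum H₁).tensor (Sectorisation.directSum H₂)).algRoute (routeDelta K)
    (fun _ _ h => ⟨h.2, h.1⟩) (fun _ _ _ h h' => ⟨h.1, h'.2⟩)

/-- `Lin_δ(⨁ k, H k)`: the block-diagonal operators. -/
noncomputable def linDiag (H : K → Type*) [∀ k, NormedAddCommGroup (H k)] [∀ k, InnerProductSpace ℂ (H k)] :
    Submodule ℂ (PiLp 2 H →ₗ[ℂ] PiLp 2 H) :=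
  (Sectorisation.directSum H).linRoute (Sectorisation.directSum H) (fun k l => k = l)

/-- The projector `∑ k, Π₁ k ⊗ Π₂ k` that enforces the sectorial correlations. -/
noncomputable def corrProjector : HExt H₁ H₂ →ₗ[ℂ] HExt H₁ H₂ :=
  ∑ k, TensorProduct.map ((Sectorisation.directSum H₁).projector k)
    ((Sectorisation.directSum H₂).projector k)

end Extended

/-! Realise the factor as $\mathrm{Lin}(H)$, and let $A$ be the image of $\mathcal A_1$. As $A$ is
closed under adjoints, orthogonal complements of invariant subspaces are invariant, so $H$ is an
orthogonal sum of minimal invariant subspaces. Let $K$ be the set of their unitary equivalence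
classes. Carrying an orthonormal basis of one representative of each class $k$ to every copy $s$ of
it gives a basis $b(k,p,s)$ of $H$, that is, $H \cong \bigoplus_k V_k \otimes \mathbb C^{S_k}$.
Members of $A$ act on $p$ alone, by a matrix independent of $s$; by Schur's lemma, operators
commuting with $A$ act on $s$ alone (`exists_orthonormalBasis_adapted`).

The isometry $J : b(k,p,s) \mapsto e_{k,p} \otimes e_{k,s}$ has $JJ^* = \tilde\Pi$. Since
$\mathrm{Lin}_\Delta$ is the corner $\tilde\Pi\,\mathrm{Lin}\,\tilde\Pi$ (`mem_linDelta_iff`),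
conjugation by $J$ is a *-isomorphism of $\mathrm{Lin}(H)$ onto it, and the two actions above give
the inclusions "$\subseteq$".

The reverse inclusions follow from commutation alone. Each $(\mathrm{id} \otimes g)\tilde\Pi$
commutes with $\iota(\mathcal A_1)$, so it comes from the commutant $\mathcal A_2$. Each $(f \otimes
\mathrm{id})\tilde\Pi$ commutes with $\iota(\mathcal A_2)$, so it comes from $\mathcal A_1'' =
\mathcal A_1$, by the double commutant theorem (`StarSubalgebra.mem_of_commute_commutant`). -/

/-! ### Intertwiners and Schur's lemma -/

section Schur

variable {α : Type*} {E F G : Type*} [NormedAddCommGroup E] [InnerProductSpace ℂ E]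
  [NormedAddCommGroup F] [InnerProductSpace ℂ F] [NormedAddCommGroup G] [InnerProductSpace ℂ G]

/-- `X` intertwines the families of operators `ρ` and `σ`. -/
def Intertwines (ρ : α → E →ₗ[ℂ] E) (σ : α → F →ₗ[ℂ] F) (X : E →ₗ[ℂ] F) : Prop :=
  ∀ a, X ∘ₗ ρ a = σ a ∘ₗ X

/-- The only subspaces invariant under all the operators `ρ a` are the two trivial ones. -/
def IsIrreducibleFamily (ρ : α → E →ₗ[ℂ] E) : Prop :=
  Nontrivial E ∧ ∀ W : Submodule ℂ E, (∀ a, ∀ x ∈ W, ρ a x ∈ W) → W = ⊥ ∨ W = ⊤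

theorem Intertwines.comp {ρ : α → E →ₗ[ℂ] E} {σ : α → F →ₗ[ℂ] F} {τ : α → G →ₗ[ℂ] G}
    {X : E →ₗ[ℂ] F} {Y : F →ₗ[ℂ] G} (hY : Intertwines σ τ Y) (hX : Intertwines ρ σ X) :
    Intertwines ρ τ (Y ∘ₗ X) := fun a => by
  rw [LinearMap.comp_assoc, hX a, ← LinearMap.comp_assoc, hY a, LinearMap.comp_assoc]

theorem Intertwines.symm {ρ : α → E →ₗ[ℂ] E} {σ : α → F →ₗ[ℂ] F} {U : E ≃ₗᵢ[ℂ] F}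
    (hU : Intertwines ρ σ U.toLinearEquiv) : Intertwines σ ρ U.symm.toLinearEquiv := fun a => by
  ext y
  have h := LinearMap.congr_fun (hU a) (U.symm y)
  simp only [LinearMap.comp_apply, LinearEquiv.coe_coe, LinearIsometryEquiv.coe_toLinearEquiv,
    LinearIsometryEquiv.apply_symm_apply] at h ⊢
  rw [← h, LinearIsometryEquiv.symm_apply_apply]

variable [FiniteDimensional ℂ E]

theorem Intertwines.adjoint [FiniteDimensional ℂ F] [Star α]
    {ρ : α → E →ₗ[ℂ] E} {σ : α → F →ₗ[ℂ] F}
    (hρ : ∀ a, ρ (star a) = (ρ a).adjoint) (hσ : ∀ a, σ (star a) = (σ a).adjoint)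
    {X : E →ₗ[ℂ] F} (hX : Intertwines ρ σ X) : Intertwines σ ρ X.adjoint := fun a => by
  have h := congrArg LinearMap.adjoint (hX (star a))
  rw [LinearMap.adjoint_comp, LinearMap.adjoint_comp, hρ, hσ, LinearMap.adjoint_adjoint,
    LinearMap.adjoint_adjoint] at h
  exact h.symm

/-- Schur's lemma for endomorphisms. -/
theorem IsIrreducibleFamily.exists_eq_smul {ρ : α → E →ₗ[ℂ] E} (hρ : IsIrreducibleFamily ρ)
    {X : E →ₗ[ℂ] E} (hX : Intertwines ρ ρ X) : ∃ c : ℂ, X = c • LinearMap.id := by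
  have := hρ.1
  obtain ⟨c, hc⟩ := Module.End.exists_eigenvalue X
  refine ⟨c, ?_⟩
  -- An eigenspace of a self-intertwiner is invariant, and it is nonzero, so it is everything.
  have h := hρ.2 (Module.End.eigenspace X c) fun a x hx => by
    rw [Module.End.mem_eigenspace_iff] at hx ⊢
    have := LinearMap.congr_fun (hX a) x
    simp only [LinearMap.comp_apply] at this
    rw [this, hx, map_smul]
  have htop := h.resolve_left hc
  ext x
  have : x ∈ Module.End.eigenspace X c := htop ▸ Submodule.mem_top
  simpa using Module.End.mem_eigenspace_iff.1 this

/-- Schur's lemma: a nonzero intertwiner of irreducible *-closed families can be normalised to a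
unitary one. -/
theorem IsIrreducibleFamily.exists_linearIsometryEquiv [FiniteDimensional ℂ F] [Star α]
    {ρ : α → E →ₗ[ℂ] E} {σ : α → F →ₗ[ℂ] F}
    (hρ : ∀ a, ρ (star a) = (ρ a).adjoint) (hσ : ∀ a, σ (star a) = (σ a).adjoint)
    (hρi : IsIrreducibleFamily ρ) (hσi : IsIrreducibleFamily σ)
    {X : E →ₗ[ℂ] F} (hX : Intertwines ρ σ X) (hX0 : X ≠ 0) :
    ∃ U : E ≃ₗᵢ[ℂ] F, Intertwines ρ σ U.toLinearEquiv := by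
  -- $X^*X$ is a self-intertwiner, hence a scalar $c$; so $X$ multiplies all norms by $\sqrt{|c|}$,
  -- and dividing by this makes it isometric.
  obtain ⟨c, hc⟩ := hρi.exists_eq_smul ((hX.adjoint hρ hσ).comp hX)
  have hnorm : ∀ x, ‖X x‖ ^ 2 = ‖c‖ * ‖x‖ ^ 2 := fun x => by
    have h : inner ℂ x (c • x) = inner ℂ (X x) (X x) := by
      rw [← LinearMap.adjoint_inner_right]
      congr 1
      simpa using (LinearMap.congr_fun hc x).symm
    rw [inner_smul_right, inner_self_eq_norm_sq_to_K, inner_self_eq_norm_sq_to_K] at h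
    have := congrArg norm h
    simpa using this.symm
  have hc0 : 0 < ‖c‖ := by
    rw [norm_pos_iff]
    rintro rfl
    refine hX0 (LinearMap.ext fun x => ?_)
    simpa using hnorm x
  set r : ℝ := Real.sqrt ‖c‖ with hr
  have hr0 : 0 < r := Real.sqrt_pos.2 hc0
  have hXr : ∀ x, ‖X x‖ = r * ‖x‖ := fun x => by
    rw [← Real.sqrt_sq (norm_nonneg (X x)), hnorm, Real.sqrt_mul (norm_nonneg c),
      Real.sqrt_sq (norm_nonneg x)]
  have hrange : LinearMap.range X = ⊤ := by
    refine (hσi.2 (LinearMap.range X) ?_).resolve_left fun h => hX0 (LinearMap.range_eq_bot.1 h)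
    rintro a _ ⟨x, rfl⟩
    exact ⟨ρ a x, LinearMap.congr_fun (hX a) x⟩
  let U₀ : E →ₗᵢ[ℂ] F :=
    { toLinearMap := ((r⁻¹ : ℝ) : ℂ) • X
      norm_map' := fun x => by
        simp only [LinearMap.smul_apply, norm_smul, hXr, Complex.norm_real, norm_inv,
          Real.norm_eq_abs, abs_of_pos hr0]
        field_simp }
  have hsurj : Function.Surjective U₀ := fun y => by
    obtain ⟨x, rfl⟩ := LinearMap.range_eq_top.1 hrange y
    refine ⟨(r : ℂ) • x, ?_⟩
    change ((r⁻¹ : ℝ) : ℂ) • X ((r : ℂ) • x) = X x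
    rw [map_smul, smul_smul, ← Complex.ofReal_mul, inv_mul_cancel₀ hr0.ne', Complex.ofReal_one,
      one_smul]
  refine ⟨LinearIsometryEquiv.ofSurjective U₀ hsurj, fun a => LinearMap.ext fun x => ?_⟩
  change ((r⁻¹ : ℝ) : ℂ) • X (ρ a x) = σ a (((r⁻¹ : ℝ) : ℂ) • X x)
  rw [map_smul]
  congr 1
  exact LinearMap.congr_fun (hX a) x

end Schur

/-! ### Minimal invariant subspaces and adapted bases -/

section Decomposition

variable {H : Type*} [NormedAddCommGroup H] [InnerProductSpace ℂ H]

/-- `V` is a minimal nonzero subspace among those that are invariant under the operators in `A`. -/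
def IsMinimalInvariant (A : Set (H →ₗ[ℂ] H)) (V : Submodule ℂ H) : Prop :=
  V ≠ ⊥ ∧ (∀ a ∈ A, ∀ x ∈ V, a x ∈ V) ∧
    ∀ W ≤ V, (∀ a ∈ A, ∀ x ∈ W, a x ∈ W) → W = ⊥ ∨ W = V

/-- The operators in `A`, restricted to an invariant subspace. -/
noncomputable def restrictFamily (A : Set (H →ₗ[ℂ] H)) (V : Submodule ℂ H)
    (hV : ∀ a ∈ A, ∀ x ∈ V, a x ∈ V) (a : A) : V →ₗ[ℂ] V :=
  (a : H →ₗ[ℂ] H).restrict (hV a a.2)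

theorem IsMinimalInvariant.isIrreducibleFamily {A : Set (H →ₗ[ℂ] H)} {V : Submodule ℂ H}
    (h : IsMinimalInvariant A V) : IsIrreducibleFamily (restrictFamily A V h.2.1) := by
  refine ⟨Submodule.nontrivial_iff_ne_bot.2 h.1, fun W hW => ?_⟩
  have hinv : ∀ a ∈ A, ∀ x ∈ W.map V.subtype, a x ∈ W.map V.subtype := by
    rintro a ha _ ⟨x, hx, rfl⟩
    exact ⟨_, hW ⟨a, ha⟩ x hx, rfl⟩
  rcases h.2.2 (W.map V.subtype) (Submodule.map_subtype_le V W) hinv with h' | h'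
  · refine .inl (Submodule.map_injective_of_injective V.injective_subtype ?_)
    rw [h', Submodule.map_bot]
  · refine .inr (Submodule.map_injective_of_injective V.injective_subtype ?_)
    rw [h', Submodule.map_subtype_top]

theorem exists_isMinimalInvariant_le [FiniteDimensional ℂ H] {A : Set (H →ₗ[ℂ] H)}
    (W : Submodule ℂ H) (hW0 : W ≠ ⊥)
    (hW : ∀ a ∈ A, ∀ x ∈ W, a x ∈ W) : ∃ V ≤ W, IsMinimalInvariant A V := by
  induction W using WellFoundedLT.induction with
  | ind W ih =>
    by_cases h : ∃ V < W, V ≠ ⊥ ∧ ∀ a ∈ A, ∀ x ∈ V, a x ∈ V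
    · obtain ⟨V, hVW, hV0, hV⟩ := h
      obtain ⟨V', hV', hm⟩ := ih V hVW hV0 hV
      exact ⟨V', hV'.trans hVW.le, hm⟩
    · refine ⟨W, le_rfl, hW0, hW, fun V hVW hV => ?_⟩
      by_contra! hne
      exact h ⟨V, lt_of_le_of_ne hVW hne.2, hne.1, hV⟩

variable [FiniteDimensional ℂ H]

/-- Split off one minimal invariant $V \le W$ and recurse on $W \cap V^\perp$, which is strictly
smaller, and invariant because $A$ is closed under adjoints. -/
theorem exists_finset_isMinimalInvariant {A : Set (H →ₗ[ℂ] H)} (hA : ∀ a ∈ A, star a ∈ A)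
    (W : Submodule ℂ H) (hW : ∀ a ∈ A, ∀ x ∈ W, a x ∈ W) :
    ∃ s : Finset (Submodule ℂ H), (∀ V ∈ s, IsMinimalInvariant A V) ∧
      (∀ V ∈ s, ∀ V' ∈ s, V ≠ V' → V ⟂ V') ∧ s.sup id = W := by
  classical
  induction W using WellFoundedLT.induction with
  | ind W ih =>
    by_cases hW0 : W = ⊥
    · exact ⟨∅, by simp, by simp, by simp [hW0]⟩
    obtain ⟨V, hVW, hV⟩ := exists_isMinimalInvariant_le W hW0 hW
    have hlt : W ⊓ Vᗮ < W := by
      refine lt_of_le_of_ne inf_le_left fun h => hV.1 ?_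
      rw [← le_bot_iff, ← Submodule.inf_orthogonal_eq_bot V]
      exact le_inf le_rfl (hVW.trans (h ▸ inf_le_right))
    obtain ⟨s, hs, hperp, hsup⟩ := ih (W ⊓ Vᗮ) hlt fun a ha x hx =>
      ⟨hW a ha x hx.1, (Submodule.mem_orthogonal _ _).2 fun y hy => by
        rw [← LinearMap.adjoint_inner_left]
        exact (Submodule.mem_orthogonal _ _).1 hx.2 _ (hV.2.1 _ (hA a ha) y hy)⟩
    have hVs : ∀ V' ∈ s, V ⟂ V' := fun V' hV' =>
      (Submodule.isOrtho_orthogonal_right V).mono_right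
        (((Finset.le_sup (f := id) hV').trans hsup.le).trans inf_le_right)
    refine ⟨insert V s, ?_, ?_, ?_⟩
    · simpa [hV] using hs
    · intro V₁ h₁ V₂ h₂ hne
      rcases Finset.mem_insert.1 h₁ with rfl | h₁' <;>
        rcases Finset.mem_insert.1 h₂ with rfl | h₂'
      · exact absurd rfl hne
      · exact hVs _ h₂'
      · exact (hVs _ h₁').symm
      · exact hperp _ h₁' _ h₂' hne
    · rw [Finset.sup_insert, hsup, id, inf_comm]
      exact Submodule.sup_orthogonal_inf_of_hasOrthogonalProjection hVW

theorem exists_isInternal_isMinimalInvariant {A : Set (H →ₗ[ℂ] H)} (hA : ∀ a ∈ A, star a ∈ A) :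
    ∃ (N : ℕ) (V : Fin N → Submodule ℂ H), (∀ i, IsMinimalInvariant A (V i)) ∧
      OrthogonalFamily ℂ (fun i => V i) (fun i => (V i).subtypeₗᵢ) ∧
      DirectSum.IsInternal V := by
  classical
  obtain ⟨s, hs, hperp, hsup⟩ := exists_finset_isMinimalInvariant hA ⊤ (fun _ _ _ _ => trivial)
  have hfam : OrthogonalFamily ℂ (fun i : Fin s.card => (s.equivFin.symm i : Submodule ℂ H))
      (fun i => (s.equivFin.symm i : Submodule ℂ H).subtypeₗᵢ) := by
    refine OrthogonalFamily.of_pairwise fun i j hij => hperp _ (Subtype.coe_prop _) _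
      (Subtype.coe_prop _) fun h => hij (s.equivFin.symm.injective (Subtype.ext h))
  refine ⟨s.card, fun i => s.equivFin.symm i, fun i => hs _ (Subtype.coe_prop _), hfam, ?_⟩
  rw [hfam.isInternal_iff, Submodule.orthogonal_eq_bot_iff, ← hsup, Finset.sup_eq_iSup,
    iSup_subtype', s.equivFin.symm.surjective.iSup_comp (g := fun V : s => (V : Submodule ℂ H))]
  rfl

theorem restrictFamily_star {A : Set (H →ₗ[ℂ] H)} (hA : ∀ a ∈ A, star a ∈ A)
    {V : Submodule ℂ H} (hV : ∀ a ∈ A, ∀ x ∈ V, a x ∈ V) (a : A) :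
    restrictFamily A V hV ⟨star a.1, hA _ a.2⟩ = (restrictFamily A V hV a).adjoint := by
  rw [LinearMap.eq_adjoint_iff]
  intro x y
  exact LinearMap.adjoint_inner_left (a : H →ₗ[ℂ] H) (y : H) (x : H)

/-- The index equivalence that groups the labels `i` according to their value under `c`. -/
def sigmaProdFiberEquiv {I K : Type*} (c : I → K) (P : K → Type*) :
    (Σ i, P (c i)) ≃ Σ k, P k × {i // c i = k} where
  toFun x := ⟨c x.1, x.2, x.1, rfl⟩
  invFun x := ⟨x.2.2.1, cast (congrArg P x.2.2.2.symm) x.2.1⟩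
  left_inv _ := rfl
  right_inv := by
    rintro ⟨_, p, i, rfl⟩
    rfl

/-- A *-closed family `A` of operators on `H` admits an adapted orthonormal basis `b (k, p, s)`:
every member of `A` acts on the label `p` alone, and every operator that commutes with `A` acts on
the label `s` alone. -/
theorem exists_orthonormalBasis_adapted {A : Set (H →ₗ[ℂ] H)} (hA : ∀ a ∈ A, star a ∈ A) :
    ∃ (K : Type) (_ : Fintype K) (P S : K → Type) (_ : ∀ k, Fintype (P k))
      (_ : ∀ k, Fintype (S k)) (b : OrthonormalBasis (Σ k, P k × S k) ℂ H),
      (∀ a ∈ A, ∃ f : ∀ k, P k → P k → ℂ,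
        ∀ k p s, a (b ⟨k, p, s⟩) = ∑ q, f k q p • b ⟨k, q, s⟩) ∧
      ∀ T : H →ₗ[ℂ] H, (∀ a ∈ A, T * a = a * T) → ∃ g : ∀ k, S k → S k → ℂ,
        ∀ k p s, T (b ⟨k, p, s⟩) = ∑ t, g k t s • b ⟨k, p, t⟩ := by
  classical
  obtain ⟨N, V, hV, hVo, hVi⟩ := exists_isInternal_isMinimalInvariant hA
  let ρ (i : Fin N) : A → V i →ₗ[ℂ] V i := restrictFamily A (V i) (hV i).2.1
  let _ : Star A := ⟨fun a => ⟨star a.1, hA _ a.2⟩⟩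
  have hρs : ∀ i (a : A), ρ i (star a) = (ρ i a).adjoint := fun i a =>
    restrictFamily_star hA (hV i).2.1 a
  have hρi : ∀ i, IsIrreducibleFamily (ρ i) := fun i => (hV i).isIrreducibleFamily
  -- The classes of this relation are the labels $k \in K$; the members of a class are the values of
  -- $s$.
  let r : Setoid (Fin N) :=
    { r := fun i j => ∃ U : V i ≃ₗᵢ[ℂ] V j, Intertwines (ρ i) (ρ j) U.toLinearEquiv
      iseqv :=
        { refl := fun i => ⟨LinearIsometryEquiv.refl ℂ (V i), fun a => rfl⟩
          symm := fun ⟨U, hU⟩ => ⟨U.symm, hU.symm⟩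
          trans := fun ⟨U, hU⟩ ⟨U', hU'⟩ => ⟨U.trans U', hU'.comp hU⟩ } }
  let c : Fin N → Quotient r := fun i => ⟦i⟧
  have hout : ∀ k (s : {i // c i = k}), ∃ U : V k.out ≃ₗᵢ[ℂ] V s.1,
      Intertwines (ρ k.out) (ρ s.1) U.toLinearEquiv := by
    rintro _ ⟨i, rfl⟩
    exact Quotient.mk_out i
  choose U hU using hout
  let β (k : Quotient r) := stdOrthonormalBasis ℂ (V k.out)
  let P (k : Quotient r) : Type := Fin (Module.finrank ℂ (V k.out))
  -- Each summand receives the basis of its class representative, transported by the unitary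
  -- intertwiner, rather than a basis of its own: this makes the matrices of $A$ the same on all
  -- copies.
  let b₀ : OrthonormalBasis (Σ i, P (c i)) ℂ H :=
    hVi.collectedOrthonormalBasis hVo fun i => (β (c i)).map (U (c i) ⟨i, rfl⟩)
  let b := b₀.reindex (sigmaProdFiberEquiv c P)
  have hb : ∀ k p s, b ⟨k, p, s⟩ = (U k s (β k p) : H) := by
    rintro _ p ⟨i, rfl⟩
    simp [b, b₀, sigmaProdFiberEquiv, DirectSum.IsInternal.collectedOrthonormalBasis]
  -- Only this is needed below: $u_{k,s}$ embeds the representative as its copy $s$ in $H$, and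
  -- intertwines the action of $A$.
  have hex : ∃ u : (k : Quotient r) → {i // c i = k} → (V k.out →ₗ[ℂ] H),
      (∀ k s, Intertwines (ρ k.out) (fun a : A => (a : H →ₗ[ℂ] H)) (u k s)) ∧
      ∀ k p s, b ⟨k, p, s⟩ = u k s (β k p) :=
    ⟨fun k s => (V s.1).subtype ∘ₗ (U k s).toLinearEquiv,
      fun k s => Intertwines.comp (fun a => rfl) (hU k s), hb⟩
  obtain ⟨u, hu, hbu⟩ := hex
  refine ⟨Quotient r, inferInstance, P, fun k => {i // c i = k}, inferInstance, inferInstance, b,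
    ?_, ?_⟩
  · intro a ha
    refine ⟨fun k q p => inner ℂ (β k q) (ρ k.out ⟨a, ha⟩ (β k p)), fun k p s => ?_⟩
    have h := LinearMap.congr_fun (hu k s ⟨a, ha⟩) (β k p)
    simp only [hbu]
    simp only [LinearMap.comp_apply] at h
    conv_lhs => rw [← h, ← (β k).sum_repr' (ρ k.out ⟨a, ha⟩ (β k p)), map_sum]
    exact Finset.sum_congr rfl fun q _ => map_smul _ _ _
  · intro T hT
    have hTi : Intertwines (fun a : A => (a : H →ₗ[ℂ] H)) (fun a : A => (a : H →ₗ[ℂ] H)) T :=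
      fun a => hT a a.2
    have hX : ∀ k s l t, Intertwines (ρ k.out) (ρ l.out) ((u l t).adjoint ∘ₗ T ∘ₗ u k s) :=
      fun k s l t => ((hu l t).adjoint (hρs _) (fun a => rfl)).comp (hTi.comp (hu k s))
    have hin : ∀ k p s l q t, inner ℂ (b ⟨l, q, t⟩) (T (b ⟨k, p, s⟩)) =
        inner ℂ (β l q) (((u l t).adjoint ∘ₗ T ∘ₗ u k s) (β k p)) := fun k p s l q t => by
      rw [hbu, hbu, LinearMap.comp_apply, LinearMap.adjoint_inner_right, LinearMap.comp_apply]
    have hg : ∀ k s t, ∃ z : ℂ, (u k t).adjoint ∘ₗ T ∘ₗ u k s = z • LinearMap.id :=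
      fun k s t => (hρi _).exists_eq_smul (hX k s k t)
    choose g hg using hg
    have hz : ∀ k s l t, k ≠ l → (u l t).adjoint ∘ₗ T ∘ₗ u k s = 0 := fun k s l t hkl => by
      by_contra h0
      obtain ⟨W, hW⟩ := (hρi _).exists_linearIsometryEquiv (hρs _) (hρs _) (hρi _) (hX k s l t) h0
      refine hkl ?_
      rw [← Quotient.out_eq k, ← Quotient.out_eq l]
      exact Quotient.sound ⟨W, hW⟩
    refine ⟨fun k t s => g k s t, fun k p s => ?_⟩
    rw [← b.sum_repr' (T (b ⟨k, p, s⟩)), Fintype.sum_sigma, Finset.sum_eq_single k]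
    · rw [Fintype.sum_prod_type, Finset.sum_eq_single p]
      · refine Finset.sum_congr rfl fun t _ => ?_
        rw [hin, hg]
        simp
      · intro q _ hq
        refine Finset.sum_eq_zero fun t _ => ?_
        rw [hin, hg]
        simp [orthonormal_iff_ite.1 (β k).orthonormal q p, hq]
      · simp
    · intro l _ hl
      refine Finset.sum_eq_zero fun x _ => ?_
      rw [hin, hz k s l _ hl.symm]
      simp
    · simp

end Decomposition

/-! ### The double commutant theorem -/

section DoubleCommutant

variable {H : Type*} [NormedAddCommGroup H] [InnerProductSpace ℂ H]

/-- The operator acting as `T` on every component of a tuple of vectors. -/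
noncomputable def amplification (I : Type*) [Fintype I] (T : H →ₗ[ℂ] H) :
    PiLp 2 (fun _ : I => H) →ₗ[ℂ] PiLp 2 (fun _ : I => H) where
  toFun x := WithLp.toLp 2 fun i => T (x i)
  map_add' x y := by ext; simp
  map_smul' c x := by ext; simp

@[simp]
theorem amplification_apply {I : Type*} [Fintype I] (T : H →ₗ[ℂ] H)
    (x : PiLp 2 (fun _ : I => H)) (i : I) : amplification I T x i = T (x i) := rfl

variable [FiniteDimensional ℂ H]

theorem inner_amplification {I : Type*} [Fintype I] (T : H →ₗ[ℂ] H)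
    (x y : PiLp 2 (fun _ : I => H)) :
    inner ℂ x (amplification I T y) = inner ℂ (amplification I (star T) x) y := by
  simp only [PiLp.inner_apply, amplification_apply]
  exact Finset.sum_congr rfl fun i _ => (LinearMap.adjoint_inner_left T _ _).symm

/-- The double commutant theorem in finite dimension. -/
theorem StarSubalgebra.mem_of_commute_commutant (A : StarSubalgebra ℂ (H →ₗ[ℂ] H))
    {T : H →ₗ[ℂ] H} (hT : ∀ B : H →ₗ[ℂ] H, (∀ a ∈ A, B * a = a * B) → T * B = B * T) :
    T ∈ A := by
  classical
  obtain ⟨I, _, ⟨e⟩⟩ : ∃ (I : Type) (_ : Fintype I), Nonempty (OrthonormalBasis I ℂ H) :=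
    ⟨_, inferInstance, ⟨stdOrthonormalBasis ℂ H⟩⟩
  -- The tuple of all basis vectors: an operator is determined by its amplification at $v$. So it
  -- suffices to show that $Tv$ lies in the orbit $W = Av$.
  let v : PiLp 2 (fun _ : I => H) := WithLp.toLp 2 fun i => e i
  let ev : (H →ₗ[ℂ] H) →ₗ[ℂ] PiLp 2 (fun _ : I => H) :=
    { toFun := fun a => amplification I a v
      map_add' := fun a b => by ext; simp
      map_smul' := fun c a => by ext; simp }
  let W : Submodule ℂ (PiLp 2 (fun _ : I => H)) :=
    (Subalgebra.toSubmodule A.toSubalgebra).map ev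
  have hW : ∀ a ∈ A, ∀ x ∈ W, amplification I a x ∈ W := by
    rintro a ha _ ⟨c, hc, rfl⟩
    exact ⟨a * c, mul_mem (S := StarSubalgebra ℂ (H →ₗ[ℂ] H)) ha hc, rfl⟩
  have hWo : ∀ a ∈ A, ∀ x ∈ Wᗮ, amplification I a x ∈ Wᗮ := fun a ha x hx =>
    (Submodule.mem_orthogonal _ _).2 fun y hy => by
      rw [inner_amplification]
      exact (Submodule.mem_orthogonal _ _).1 hx _ (hW _ (star_mem ha) y hy)
  let Q : PiLp 2 (fun _ : I => H) →ₗ[ℂ] PiLp 2 (fun _ : I => H) := W.starProjection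
  have hQW : ∀ x ∈ W, Q x = x := fun x hx => Submodule.starProjection_eq_self_iff.2 hx
  have hQ : ∀ a ∈ A, ∀ x, Q (amplification I a x) = amplification I a (Q x) := fun a ha x => by
    have h1 : Q (amplification I a (Q x)) = amplification I a (Q x) :=
      hQW _ (hW a ha _ (W.starProjection_apply_mem x))
    have h2 : Q (amplification I a (x - Q x)) = 0 :=
      (Submodule.starProjection_apply_eq_zero_iff W).2
        (hWo a ha _ (W.sub_starProjection_mem_orthogonal x))
    rw [map_sub, map_sub, sub_eq_zero] at h2
    rw [h2, h1]
  let inj (j : I) : H →ₗ[ℂ] PiLp 2 (fun _ : I => H) :=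
    { toFun := fun x => PiLp.single 2 j x
      map_add' := fun x y => by ext i; by_cases h : i = j <;> simp [h]
      map_smul' := fun c x => by ext i; by_cases h : i = j <;> simp [h] }
  have hinj : ∀ (B : H →ₗ[ℂ] H) j x, amplification I B (inj j x) = inj j (B x) := fun B j x => by
    ext i
    by_cases h : i = j <;> simp [inj, h]
  have hsum : ∀ x, ∑ j, inj j (x j) = x := fun x => by
    ext i
    simp [inj, Pi.single_apply]
  let pr (i : I) : PiLp 2 (fun _ : I => H) →ₗ[ℂ] H :=
    { toFun := fun x => x i
      map_add' := fun _ _ => rfl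
      map_smul' := fun _ _ => rfl }
  -- $Q$ commutes with the amplification of $A$, so its matrix entries lie in the commutant of $A$
  -- and hence commute with $T$.
  have hTQ : ∀ i j, T * (pr i ∘ₗ Q ∘ₗ inj j) = (pr i ∘ₗ Q ∘ₗ inj j) * T := fun i j =>
    hT _ fun a ha => LinearMap.ext fun x => by
      change Q (inj j (a x)) i = a (Q (inj j x) i)
      rw [← hinj, hQ a ha]
      rfl
  have hQT : ∀ x, Q (amplification I T x) = amplification I T (Q x) := fun x => by
    rw [← hsum x, map_sum, map_sum, map_sum, map_sum]
    refine Finset.sum_congr rfl fun j _ => ?_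
    ext i
    rw [hinj]
    exact (LinearMap.congr_fun (hTQ i j) (x j)).symm
  -- Unitality of $A$ puts $v$ in its own orbit; then $Tv = TQv = QTv \in W$.
  have hv : v ∈ W := ⟨1, one_mem A, by ext; simp [ev]⟩
  have hTv : amplification I T v ∈ W := by
    rw [← hQW v hv, ← hQT]
    exact W.starProjection_apply_mem _
  obtain ⟨a, ha, hav⟩ := hTv
  have haT : a = T := e.toBasis.ext fun i => by
    have := congrArg (fun x : PiLp 2 (fun _ : I => H) => x i) hav
    simpa [ev, v] using this
  exact haT ▸ ha

end DoubleCommutant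

/-! ### Sector projectors -/

namespace Sectorisation

section Projector

variable {K : Type*} {H : Type*} [NormedAddCommGroup H] [InnerProductSpace ℂ H]
  [FiniteDimensional ℂ H] (S : Sectorisation K H)

theorem projector_mem (k : K) (x : H) : S.projector k x ∈ S.sector k :=
  Submodule.starProjection_apply_mem _ x

theorem projector_apply_of_mem [DecidableEq K] {j : K} (k : K) {x : H} (hx : x ∈ S.sector j) :
    S.projector k x = if j = k then x else 0 := by
  split_ifs with h
  · subst h
    exact Submodule.starProjection_eq_self_iff.2 hx
  · exact (Submodule.starProjection_apply_eq_zero_iff _).2 (S.orthogonal _ _ h hx)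

end Projector

end Sectorisation

/-! ### The correlation projector and its corner algebra -/

section Corr

open Sectorisation

variable {K : Type*} [Fintype K] {H₁ H₂ : K → Type*}
  [∀ k, NormedAddCommGroup (H₁ k)] [∀ k, InnerProductSpace ℂ (H₁ k)]
  [∀ k, NormedAddCommGroup (H₂ k)] [∀ k, InnerProductSpace ℂ (H₂ k)]

theorem mem_linDiag {f : PiLp 2 H₁ →ₗ[ℂ] PiLp 2 H₁} :
    f ∈ linDiag H₁ ↔
      ∀ k, ∀ x ∈ (directSum H₁).sector k, f x ∈ (directSum H₁).sector k := by
  refine forall_congr' fun k => forall₂_congr fun x _ => ?_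
  rw [iSup_iSup_eq_right]

theorem id_mem_linDiag : LinearMap.id ∈ linDiag H₁ := mem_linDiag.2 fun _ _ h => h

theorem HExt.hom_ext {M : Type*} [AddCommGroup M] [Module ℂ M] {f g : HExt H₁ H₂ →ₗ[ℂ] M}
    (h : ∀ k l, ∀ x ∈ (directSum H₁).sector k, ∀ y ∈ (directSum H₂).sector l,
      f (x ⊗ₜ y) = g (x ⊗ₜ y)) : f = g := by
  rw [← LinearMap.eqLocus_eq_top, eq_top_iff, ← ((directSum H₁).tensor (directSum H₂)).spans]
  refine iSup_le fun p => Submodule.map₂_le.2 fun x hx y hy => ?_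
  exact h p.1 p.2 x hx y hy

variable [∀ k, FiniteDimensional ℂ (H₁ k)] [∀ k, FiniteDimensional ℂ (H₂ k)]

theorem corrProjector_tmul [DecidableEq K] {k l : K} {x : PiLp 2 H₁} {y : PiLp 2 H₂}
    (hx : x ∈ (directSum H₁).sector k) (hy : y ∈ (directSum H₂).sector l) :
    corrProjector H₁ H₂ (x ⊗ₜ y) = if k = l then x ⊗ₜ y else 0 := by
  have h : ∀ j, TensorProduct.map ((directSum H₁).projector j) ((directSum H₂).projector j)
      (x ⊗ₜ y) = if k = j then (if k = l then x ⊗ₜ y else 0) else 0 := fun j => by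
    rw [TensorProduct.map_tmul, projector_apply_of_mem _ j hx, projector_apply_of_mem _ j hy]
    split_ifs <;> simp_all
  rw [corrProjector, LinearMap.sum_apply, Finset.sum_congr rfl fun j _ => h j]
  simp

theorem corrProjector_mul_self :
    corrProjector H₁ H₂ * corrProjector H₁ H₂ = corrProjector H₁ H₂ := by
  classical
  refine HExt.hom_ext fun k l x hx y hy => ?_
  rw [Module.End.mul_apply, corrProjector_tmul hx hy]
  split_ifs with h
  · rw [corrProjector_tmul hx hy, if_pos h]
  · exact map_zero _

/-- Block-diagonal maps preserve both labels, and $\tilde\Pi$ only tests whether these agree. -/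
theorem commute_corrProjector_map {f : PiLp 2 H₁ →ₗ[ℂ] PiLp 2 H₁}
    {g : PiLp 2 H₂ →ₗ[ℂ] PiLp 2 H₂} (hf : f ∈ linDiag H₁) (hg : g ∈ linDiag H₂) :
    corrProjector H₁ H₂ * TensorProduct.map f g = TensorProduct.map f g * corrProjector H₁ H₂ := by
  classical
  refine HExt.hom_ext fun k l x hx y hy => ?_
  rw [Module.End.mul_apply, Module.End.mul_apply, corrProjector_tmul hx hy,
    TensorProduct.map_tmul,
    corrProjector_tmul (mem_linDiag.1 hf k x hx) (mem_linDiag.1 hg l y hy)]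
  split_ifs <;> simp

/-- The route $\Delta$ says that $T$ kills the sectors with unequal labels and takes values in the
sum of those with equal labels, the range of $\tilde\Pi$. Thus $\mathrm{Lin}_\Delta$ is a corner
with unit $\tilde\Pi$. -/
theorem mem_linDelta_iff {T : HExt H₁ H₂ →ₗ[ℂ] HExt H₁ H₂} :
    T ∈ linDelta H₁ H₂ ↔ corrProjector H₁ H₂ * T * corrProjector H₁ H₂ = T := by
  classical
  set Z := (directSum H₁).tensor (directSum H₂)
  constructor
  · intro hT
    refine HExt.hom_ext fun k l x hx y hy => ?_
    have hxy : T (x ⊗ₜ y) ∈ ⨆ q : K × K, ⨆ _ : routeDelta K (k, l) q, Z.sector q :=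
      hT (k, l) _ (Submodule.apply_mem_map₂ (TensorProduct.mk ℂ _ _) hx hy)
    rw [Module.End.mul_apply, Module.End.mul_apply, corrProjector_tmul hx hy]
    split_ifs with h
    · have hle : (⨆ q : K × K, ⨆ _ : routeDelta K (k, l) q, Z.sector q) ≤
          LinearMap.eqLocus (corrProjector H₁ H₂) LinearMap.id := by
        refine iSup₂_le fun q hq => Submodule.map₂_le.2 fun z hz w hw => ?_
        have := corrProjector_tmul hz hw
        rwa [if_pos hq.2] at this
      exact hle hxy
    · have hbot : (⨆ q : K × K, ⨆ _ : routeDelta K (k, l) q, Z.sector q) = ⊥ := by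
        refine le_bot_iff.1 (iSup₂_le fun q hq => absurd hq.1 h)
      rw [hbot, Submodule.mem_bot] at hxy
      rw [hxy, map_zero, map_zero]
  · rintro hT ⟨k, l⟩ x hx
    by_cases h : k = l
    · rw [← hT, Module.End.mul_apply, Module.End.mul_apply]
      generalize T (corrProjector H₁ H₂ x) = z
      rw [corrProjector, LinearMap.sum_apply]
      refine sum_mem fun j _ => ?_
      refine Submodule.mem_iSup_of_mem (j, j) (Submodule.mem_iSup_of_mem ⟨h, rfl⟩ ?_)
      induction z using TensorProduct.induction_on with
      | zero => rw [map_zero]; exact zero_mem _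
      | add z w hz hw => rw [map_add]; exact add_mem hz hw
      | tmul z w =>
        exact Submodule.apply_mem_map₂ (TensorProduct.mk ℂ _ _) (projector_mem _ j z)
          (projector_mem _ j w)
    · have hle : Z.sector (k, l) ≤ LinearMap.ker (corrProjector H₁ H₂) := by
        refine Submodule.map₂_le.2 fun z hz w hw => ?_
        have := corrProjector_tmul hz hw
        rwa [if_neg h] at this
      rw [← hT, Module.End.mul_apply, LinearMap.mem_ker.1 (hle hx), map_zero]
      exact zero_mem _

theorem map_mul_corrProjector_mem_linDelta {f : PiLp 2 H₁ →ₗ[ℂ] PiLp 2 H₁}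
    {g : PiLp 2 H₂ →ₗ[ℂ] PiLp 2 H₂} (hf : f ∈ linDiag H₁) (hg : g ∈ linDiag H₂) :
    TensorProduct.map f g * corrProjector H₁ H₂ ∈ linDelta H₁ H₂ := by
  rw [mem_linDelta_iff, ← mul_assoc, commute_corrProjector_map hf hg, mul_assoc, mul_assoc,
    corrProjector_mul_self, corrProjector_mul_self]

/-- The source of both reverse inclusions: $f \otimes \mathrm{id}$, $\mathrm{id} \otimes g$ and
$\tilde\Pi$ commute pairwise. -/
theorem commute_map_mul_corrProjector {f : PiLp 2 H₁ →ₗ[ℂ] PiLp 2 H₁}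
    {g : PiLp 2 H₂ →ₗ[ℂ] PiLp 2 H₂} (hf : f ∈ linDiag H₁) (hg : g ∈ linDiag H₂) :
    Commute (TensorProduct.map f LinearMap.id * corrProjector H₁ H₂)
      (TensorProduct.map LinearMap.id g * corrProjector H₁ H₂) := by
  have h₁ := commute_corrProjector_map (H₂ := H₂) hf id_mem_linDiag
  have h₂ := commute_corrProjector_map (H₁ := H₁) id_mem_linDiag hg
  have h₃ : Commute (TensorProduct.map f (LinearMap.id : PiLp 2 H₂ →ₗ[ℂ] PiLp 2 H₂))
      (TensorProduct.map (LinearMap.id : PiLp 2 H₁ →ₗ[ℂ] PiLp 2 H₁) g) := by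
    rw [Commute, SemiconjBy, Module.End.mul_eq_comp, Module.End.mul_eq_comp,
      ← TensorProduct.map_comp, ← TensorProduct.map_comp]
    rfl
  have h₁' : Commute (corrProjector H₁ H₂) _ := h₁
  have h₂' : Commute (corrProjector H₁ H₂) _ := h₂
  exact (h₃.mul_right h₁'.symm).mul_left (h₂'.mul_right (Commute.refl _))

end Corr

/-! ### Transport of bipartitions along *-isomorphisms -/

section Transport

variable {ω ω' : Type*} [Ring ω] [StarRing ω] [Algebra ℂ ω] [StarModule ℂ ω]
  [Ring ω'] [StarRing ω'] [Algebra ℂ ω'] [StarModule ℂ ω']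

theorem mem_map_iff_mem (Φ : ω ≃⋆ₐ[ℂ] ω') (A : StarSubalgebra ℂ ω) {x : ω} :
    Φ x ∈ A.map (Φ : ω →⋆ₐ[ℂ] ω') ↔ x ∈ A :=
  ⟨fun ⟨_, ha, hax⟩ => Φ.injective hax ▸ ha, fun h => ⟨x, h, rfl⟩⟩

theorem IsBipartition.mem_iff_commute_map {A₁ A₂ : StarSubalgebra ℂ ω}
    (hA : IsBipartition A₁ A₂) (Φ : ω ≃⋆ₐ[ℂ] ω') {x : ω} :
    x ∈ A₂ ↔ ∀ a ∈ A₁.map (Φ : ω →⋆ₐ[ℂ] ω'), Φ x * a = a * Φ x := by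
  rw [← SetLike.mem_coe, hA]
  constructor
  · rintro hx _ ⟨a, ha, rfl⟩
    change Φ x * Φ a = Φ a * Φ x
    rw [← map_mul, hx a ha, map_mul]
  · intro hx a ha
    refine Φ.injective ?_
    rw [map_mul, map_mul]
    exact hx _ ((mem_map_iff_mem Φ A₁).2 ha)

end Transport

/-! ### Conjugation onto $\mathrm{Lin}_\Delta$ and the two images -/

section Isometry

open Sectorisation

variable {K : Type*} [Fintype K] {H₁ H₂ : K → Type*}
  [∀ k, NormedAddCommGroup (H₁ k)] [∀ k, InnerProductSpace ℂ (H₁ k)]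
  [∀ k, FiniteDimensional ℂ (H₁ k)]
  [∀ k, NormedAddCommGroup (H₂ k)] [∀ k, InnerProductSpace ℂ (H₂ k)]
  [∀ k, FiniteDimensional ℂ (H₂ k)]
  {H : Type*} [NormedAddCommGroup H] [InnerProductSpace ℂ H] [FiniteDimensional ℂ H]

/-- Conjugation by an isometry whose range is that of the correlation projector identifies the
operators on `H` with `Lin_Δ`. -/
noncomputable def conjIsometry (J : H →ₗ[ℂ] HExt H₁ H₂) (hJ : J.adjoint ∘ₗ J = LinearMap.id)
    (hJP : J ∘ₗ J.adjoint = corrProjector H₁ H₂) : (H →ₗ[ℂ] H) ≃⋆ₐ[ℂ] linDelta H₁ H₂ where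
  toFun T := ⟨J ∘ₗ T ∘ₗ J.adjoint, mem_linDelta_iff.2 (by
    have h : ∀ x, J.adjoint (J x) = x := LinearMap.congr_fun hJ
    rw [← hJP]
    exact LinearMap.ext fun x => by simp [h])⟩
  invFun T := J.adjoint ∘ₗ (T : HExt H₁ H₂ →ₗ[ℂ] HExt H₁ H₂) ∘ₗ J
  left_inv T := by
    have h : ∀ x, J.adjoint (J x) = x := LinearMap.congr_fun hJ
    ext x
    simp [h]
  right_inv T := by
    have h := mem_linDelta_iff.1 T.2
    rw [← hJP] at h
    exact Subtype.ext h
  map_mul' S T := by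
    have h : ∀ x, J.adjoint (J x) = x := LinearMap.congr_fun hJ
    refine Subtype.ext (LinearMap.ext fun x => ?_)
    simp [h]
  map_add' S T := by
    refine Subtype.ext (LinearMap.ext fun x => ?_)
    simp
  map_star' T := by
    refine Subtype.ext ?_
    change _ = LinearMap.adjoint _
    rw [LinearMap.adjoint_comp, LinearMap.adjoint_comp, LinearMap.adjoint_adjoint,
      LinearMap.comp_assoc]
    rfl
  map_smul' c T := by
    refine Subtype.ext (LinearMap.ext fun x => ?_)
    simp

/-- If an isometry `J` onto the range of the correlation projector turns the members of `A₁` into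
operators on the first factor, and those of its commutant into operators on the second one, then
the subalgebras are exactly the algebras of such operators. -/
theorem exists_starAlgEquiv_linDelta {ω : Type*} [Ring ω] [StarRing ω] [Algebra ℂ ω]
    [StarModule ℂ ω] (A₁ A₂ : StarSubalgebra ℂ ω) (hA : IsBipartition A₁ A₂)
    (Φ : ω ≃⋆ₐ[ℂ] (H →ₗ[ℂ] H)) (J : H →ₗ[ℂ] HExt H₁ H₂)
    (hJ : J.adjoint ∘ₗ J = LinearMap.id) (hJP : J ∘ₗ J.adjoint = corrProjector H₁ H₂)
    (h₁ : ∀ x ∈ A₁, ∃ f ∈ linDiag H₁, J ∘ₗ Φ x ∘ₗ J.adjoint =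
      TensorProduct.map f LinearMap.id ∘ₗ corrProjector H₁ H₂)
    (h₂ : ∀ x ∈ A₂, ∃ g ∈ linDiag H₂, J ∘ₗ Φ x ∘ₗ J.adjoint =
      TensorProduct.map LinearMap.id g ∘ₗ corrProjector H₁ H₂) :
    ∃ ι : ω ≃⋆ₐ[ℂ] linDelta H₁ H₂,
      (fun a : ω => (ι a : HExt H₁ H₂ →ₗ[ℂ] HExt H₁ H₂)) '' (A₁ : Set ω) =
        {T | ∃ f ∈ linDiag H₁,
          T = TensorProduct.map f LinearMap.id ∘ₗ corrProjector H₁ H₂} ∧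
      (fun a : ω => (ι a : HExt H₁ H₂ →ₗ[ℂ] HExt H₁ H₂)) '' (A₂ : Set ω) =
        {T | ∃ g ∈ linDiag H₂,
          T = TensorProduct.map LinearMap.id g ∘ₗ corrProjector H₁ H₂} := by
  let ι : ω ≃⋆ₐ[ℂ] linDelta H₁ H₂ := Φ.trans (conjIsometry J hJ hJP)
  have hcomm : ∀ x y, Commute (ι x : HExt H₁ H₂ →ₗ[ℂ] HExt H₁ H₂) (ι y) → x * y = y * x :=
    fun x y h => ι.injective (Subtype.ext (by rw [map_mul, map_mul]; exact h))
  refine ⟨ι, Set.Subset.antisymm ?_ ?_, Set.Subset.antisymm ?_ ?_⟩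
  · rintro _ ⟨x, hx, rfl⟩
    exact h₁ x hx
  · rintro _ ⟨f, hf, rfl⟩
    obtain ⟨x, hx⟩ :=
      EquivLike.surjective ι ⟨_, map_mul_corrProjector_mem_linDelta hf id_mem_linDiag⟩
    have hx' := congrArg Subtype.val hx
    refine ⟨x, ?_, hx'⟩
    -- By the double commutant theorem it is enough to commute with $\mathcal A_1' = \mathcal A_2$,
    -- whose elements are already known to have the form $(\mathrm{id} \otimes g)\tilde\Pi$.
    refine (mem_map_iff_mem Φ A₁).1 (StarSubalgebra.mem_of_commute_commutant _ fun B hB => ?_)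
    obtain ⟨y, rfl⟩ := EquivLike.surjective Φ B
    obtain ⟨g, hg, hy⟩ := h₂ y ((hA.mem_iff_commute_map Φ).2 hB)
    rw [← map_mul, ← map_mul, hcomm x y]
    rw [hx', show (ι y : HExt H₁ H₂ →ₗ[ℂ] HExt H₁ H₂) = _ from hy]
    exact commute_map_mul_corrProjector hf hg
  · rintro _ ⟨x, hx, rfl⟩
    exact h₂ x hx
  · rintro _ ⟨g, hg, rfl⟩
    obtain ⟨x, hx⟩ :=
      EquivLike.surjective ι ⟨_, map_mul_corrProjector_mem_linDelta id_mem_linDiag hg⟩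
    have hx' := congrArg Subtype.val hx
    -- Here the definition of $\mathcal A_2$ as a commutant suffices.
    refine ⟨x, hA.symm ▸ fun a ha => ?_, hx'⟩
    obtain ⟨f, hf, ha'⟩ := h₁ a ha
    refine hcomm x a ?_
    rw [hx', show (ι a : HExt H₁ H₂ →ₗ[ℂ] HExt H₁ H₂) = _ from ha']
    exact (commute_map_mul_corrProjector hf hg).symm

end Isometry

/-! ### The isometry defined by an adapted basis -/

section Adapted

open Sectorisation

variable {K : Type*} [Fintype K] {P S : K → Type*} [∀ k, Fintype (P k)] [∀ k, Fintype (S k)]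

/-- The block-diagonal operator with the given matrices as blocks. -/
noncomputable def blockDiagonalOperator (f : ∀ k, P k → P k → ℂ) :
    PiLp 2 (fun k => EuclideanSpace ℂ (P k)) →ₗ[ℂ] PiLp 2 (fun k => EuclideanSpace ℂ (P k)) where
  toFun x := WithLp.toLp 2 fun k => WithLp.toLp 2 fun p => ∑ q, f k p q * x k q
  map_add' x y := by ext; simp [mul_add, Finset.sum_add_distrib]
  map_smul' c x := by ext; simp [Finset.mul_sum, mul_left_comm]

theorem blockDiagonalOperator_mem_linDiag (f : ∀ k, P k → P k → ℂ) :
    blockDiagonalOperator f ∈ linDiag fun k => EuclideanSpace ℂ (P k) :=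
  mem_linDiag.2 fun k x hx j hj => by
    ext p
    simp [blockDiagonalOperator, hx j hj]

variable (P) in
/-- The standard orthonormal basis of a direct sum of coordinate spaces. -/
noncomputable def sumBasis :
    OrthonormalBasis (Σ k, P k) ℂ (PiLp 2 fun k => EuclideanSpace ℂ (P k)) :=
  Pi.orthonormalBasis fun k => EuclideanSpace.basisFun (P k) ℂ

theorem sumBasis_mem_sector (k : K) (p : P k) :
    sumBasis P ⟨k, p⟩ ∈ (directSum fun k => EuclideanSpace ℂ (P k)).sector k := by
  classical
  intro j hj
  simp [sumBasis, hj]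

theorem blockDiagonalOperator_sumBasis (f : ∀ k, P k → P k → ℂ) (k : K) (p : P k) :
    blockDiagonalOperator f (sumBasis P ⟨k, p⟩) = ∑ q, f k q p • sumBasis P ⟨k, q⟩ := by
  classical
  ext j r
  by_cases h : j = k
  · subst h
    simp [blockDiagonalOperator, sumBasis, WithLp.ofLp_sum, Pi.single_apply]
  · simp [blockDiagonalOperator, sumBasis, WithLp.ofLp_sum, h]

variable {H : Type*} [NormedAddCommGroup H] [InnerProductSpace ℂ H]

/-- The isometry that sends `b (k, p, s)` to the tensor product of the basis vectors `(k, p)`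
and `(k, s)`. -/
noncomputable def adaptedIsometry (b : OrthonormalBasis (Σ k, P k × S k) ℂ H) :
    H →ₗ[ℂ] HExt (fun k => EuclideanSpace ℂ (P k)) (fun k => EuclideanSpace ℂ (S k)) :=
  b.toBasis.constr ℂ fun x => sumBasis P ⟨x.1, x.2.1⟩ ⊗ₜ sumBasis S ⟨x.1, x.2.2⟩

theorem adaptedIsometry_apply (b : OrthonormalBasis (Σ k, P k × S k) ℂ H) (k : K) (p : P k)
    (s : S k) : adaptedIsometry b (b ⟨k, p, s⟩) = sumBasis P ⟨k, p⟩ ⊗ₜ sumBasis S ⟨k, s⟩ := by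
  rw [adaptedIsometry, ← b.coe_toBasis, Module.Basis.constr_basis]

variable [FiniteDimensional ℂ H]

theorem adjoint_comp_adaptedIsometry (b : OrthonormalBasis (Σ k, P k × S k) ℂ H) :
    (adaptedIsometry b).adjoint ∘ₗ adaptedIsometry b = LinearMap.id := by
  classical
  refine b.toBasis.ext fun x => InnerProductSpace.ext_inner_left_basis b.toBasis fun y => ?_
  obtain ⟨k, p, s⟩ := x
  obtain ⟨l, q, t⟩ := y
  rw [b.coe_toBasis, LinearMap.comp_apply, LinearMap.adjoint_inner_right, adaptedIsometry_apply,
    adaptedIsometry_apply, TensorProduct.inner_tmul, LinearMap.id_apply,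
    orthonormal_iff_ite.1 b.orthonormal, orthonormal_iff_ite.1 (sumBasis P).orthonormal,
    orthonormal_iff_ite.1 (sumBasis S).orthonormal]
  by_cases h : l = k
  · subst h
    by_cases hp : q = p <;> by_cases hs : t = s <;> simp [hp, hs]
  · simp [h]

/-- Such a tensor is orthogonal to the range of the isometry, which is spanned by tensors with equal
labels. -/
theorem adjoint_adaptedIsometry_of_ne (b : OrthonormalBasis (Σ k, P k × S k) ℂ H) {k l : K}
    (h : k ≠ l) (p : P k) (s : S l) :
    (adaptedIsometry b).adjoint (sumBasis P ⟨k, p⟩ ⊗ₜ sumBasis S ⟨l, s⟩) = 0 := by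
  classical
  refine InnerProductSpace.ext_inner_left_basis b.toBasis fun y => ?_
  obtain ⟨j, q, t⟩ := y
  rw [b.coe_toBasis, LinearMap.adjoint_inner_right, adaptedIsometry_apply,
    TensorProduct.inner_tmul, orthonormal_iff_ite.1 (sumBasis P).orthonormal,
    orthonormal_iff_ite.1 (sumBasis S).orthonormal, inner_zero_right]
  by_cases hj : j = k
  · have : j ≠ l := fun e => h (hj ▸ e)
    simp [this]
  · simp [hj]

theorem adjoint_adaptedIsometry_apply (b : OrthonormalBasis (Σ k, P k × S k) ℂ H) (k : K)
    (p : P k) (s : S k) :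
    (adaptedIsometry b).adjoint (sumBasis P ⟨k, p⟩ ⊗ₜ sumBasis S ⟨k, s⟩) = b ⟨k, p, s⟩ := by
  rw [← adaptedIsometry_apply b]
  exact LinearMap.congr_fun (adjoint_comp_adaptedIsometry b) _

theorem HExt.basis_ext {M : Type*} [AddCommGroup M] [Module ℂ M]
    {f g : HExt (fun k => EuclideanSpace ℂ (P k)) (fun k => EuclideanSpace ℂ (S k)) →ₗ[ℂ] M}
    (h : ∀ k p l s, f (sumBasis P ⟨k, p⟩ ⊗ₜ sumBasis S ⟨l, s⟩) =
      g (sumBasis P ⟨k, p⟩ ⊗ₜ sumBasis S ⟨l, s⟩)) : f = g := by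
  refine ((sumBasis P).toBasis.tensorProduct (sumBasis S).toBasis).ext fun x => ?_
  obtain ⟨⟨k, p⟩, ⟨l, s⟩⟩ := x
  simpa [Module.Basis.tensorProduct_apply] using h k p l s

theorem adaptedIsometry_comp_adjoint (b : OrthonormalBasis (Σ k, P k × S k) ℂ H) :
    adaptedIsometry b ∘ₗ (adaptedIsometry b).adjoint = corrProjector _ _ := by
  classical
  refine HExt.basis_ext fun k p l s => ?_
  rw [corrProjector_tmul (sumBasis_mem_sector k p) (sumBasis_mem_sector l s),
    LinearMap.comp_apply]
  split_ifs with h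
  · subst h
    rw [adjoint_adaptedIsometry_apply, adaptedIsometry_apply]
  · rw [adjoint_adaptedIsometry_of_ne b h, map_zero]

theorem adaptedIsometry_conj_left (b : OrthonormalBasis (Σ k, P k × S k) ℂ H) {T : H →ₗ[ℂ] H}
    {f : ∀ k, P k → P k → ℂ} (hT : ∀ k p s, T (b ⟨k, p, s⟩) = ∑ q, f k q p • b ⟨k, q, s⟩) :
    adaptedIsometry b ∘ₗ T ∘ₗ (adaptedIsometry b).adjoint =
      TensorProduct.map (blockDiagonalOperator f) LinearMap.id ∘ₗ corrProjector _ _ := by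
  classical
  refine HExt.basis_ext fun k p l s => ?_
  simp only [LinearMap.comp_apply]
  rw [corrProjector_tmul (sumBasis_mem_sector k p) (sumBasis_mem_sector l s)]
  split_ifs with h
  · subst h
    rw [adjoint_adaptedIsometry_apply, hT, TensorProduct.map_tmul, blockDiagonalOperator_sumBasis,
      map_sum, TensorProduct.sum_tmul]
    refine Finset.sum_congr rfl fun q _ => ?_
    rw [map_smul, adaptedIsometry_apply, TensorProduct.smul_tmul']
    rfl
  · rw [adjoint_adaptedIsometry_of_ne b h, map_zero, map_zero, map_zero]

theorem adaptedIsometry_conj_right (b : OrthonormalBasis (Σ k, P k × S k) ℂ H) {T : H →ₗ[ℂ] H}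
    {g : ∀ k, S k → S k → ℂ} (hT : ∀ k p s, T (b ⟨k, p, s⟩) = ∑ t, g k t s • b ⟨k, p, t⟩) :
    adaptedIsometry b ∘ₗ T ∘ₗ (adaptedIsometry b).adjoint =
      TensorProduct.map LinearMap.id (blockDiagonalOperator g) ∘ₗ corrProjector _ _ := by
  classical
  refine HExt.basis_ext fun k p l s => ?_
  simp only [LinearMap.comp_apply]
  rw [corrProjector_tmul (sumBasis_mem_sector k p) (sumBasis_mem_sector l s)]
  split_ifs with h
  · subst h
    rw [adjoint_adaptedIsometry_apply, hT, TensorProduct.map_tmul, blockDiagonalOperator_sumBasis,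
      map_sum, TensorProduct.tmul_sum]
    refine Finset.sum_congr rfl fun q _ => ?_
    rw [map_smul, adaptedIsometry_apply, TensorProduct.tmul_smul]
    rfl
  · rw [adjoint_adaptedIsometry_of_ne b h, map_zero, map_zero, map_zero]

end Adapted

/-! ### The representation theorem for bipartitions -/

theorem mainTheorem2 {ω : Type u} [Ring ω] [StarRing ω] [Algebra ℂ ω] [StarModule ℂ ω]
    (hω : IsFactor.{u, v} ω) (A₁ A₂ : StarSubalgebra ℂ ω) (hA : IsBipartition A₁ A₂) :
    ∃ (K : Type) (_ : Fintype K) (H₁ H₂ : K → Type)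
      (_ : ∀ k, NormedAddCommGroup (H₁ k)) (_ : ∀ k, InnerProductSpace ℂ (H₁ k))
      (_ : ∀ k, FiniteDimensional ℂ (H₁ k))
      (_ : ∀ k, NormedAddCommGroup (H₂ k)) (_ : ∀ k, InnerProductSpace ℂ (H₂ k))
      (_ : ∀ k, FiniteDimensional ℂ (H₂ k))
      (ι : ω ≃⋆ₐ[ℂ] linDelta H₁ H₂),
      (fun a : ω => (ι a : HExt H₁ H₂ →ₗ[ℂ] HExt H₁ H₂)) '' (A₁ : Set ω) =
        {T | ∃ f ∈ linDiag H₁,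
          T = TensorProduct.map f LinearMap.id ∘ₗ corrProjector H₁ H₂} ∧
      (fun a : ω => (ι a : HExt H₁ H₂ →ₗ[ℂ] HExt H₁ H₂)) '' (A₂ : Set ω) =
        {T | ∃ g ∈ linDiag H₂,
          T = TensorProduct.map LinearMap.id g ∘ₗ corrProjector H₁ H₂} := by
  obtain ⟨H, _, _, _, ⟨Φ⟩⟩ := hω
  obtain ⟨K, _, P, S, _, _, b, hb₁, hb₂⟩ := exists_orthonormalBasis_adapted
    (A := (A₁.map (Φ : ω →⋆ₐ[ℂ] (H →ₗ[ℂ] H)) : Set (H →ₗ[ℂ] H))) fun a ha => star_mem ha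
  have h := exists_starAlgEquiv_linDelta (H₁ := fun k => EuclideanSpace ℂ (P k))
    (H₂ := fun k => EuclideanSpace ℂ (S k)) A₁ A₂ hA Φ (adaptedIsometry b)
    (adjoint_comp_adaptedIsometry b) (adaptedIsometry_comp_adjoint b)
    (fun x hx => by
      obtain ⟨f, hf⟩ := hb₁ _ ((mem_map_iff_mem Φ A₁).2 hx)
      exact ⟨_, blockDiagonalOperator_mem_linDiag f, adaptedIsometry_conj_left b hf⟩)
    (fun x hx => by
      obtain ⟨g, hg⟩ := hb₂ _ ((hA.mem_iff_commute_map Φ).1 hx)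
      exact ⟨_, blockDiagonalOperator_mem_linDiag g, adaptedIsometry_conj_right b hg⟩)
  exact ⟨K, _, _, _, _, _, _, _, _, _, h⟩
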